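/- **Setting.** Let $\Theta\subset\mathbb R^3$ be a bounded domain, $\mathbb H=L^2(\Theta)^3\times L^2(\Theta)^3$, and let $M(\mathbf E,\mathbf H)=(\nabla\times\mathbf H,-\nabla\times\mathbf E)$ be the Maxwell operator with domain $\mathcal D(M)=H_0(\mathrm{curl},\Theta)\times H(\mathrm{curl},\Theta)$. Put $\mathcal D(M^2)=\{u\in\mathcal D(M): Mu\in\mathcal D(M)\}$, with inner product $\langle u,v\rangle_{\mathcal D(M^2)}=\langle u,v\rangle_{\mathbb H}+\langle M^2u,M^2v\rangle_{\mathbb H}$ and the corresponding norm. Let $Q$ be a bounded symmetric positive definite operator on $L^2(\Theta)$, $(e_j)_{j\in\mathbb N}$ an orthonormal basis of $L^2(\Theta)$, and $U_0=Q^{1/2}(L^2(\Theta))$ with the norm $\|Q^{1/2}g\|_{U_0}=\|g\|_{L^2(\Theta)}$, so that $(Q^{1/2}e_j)_j$ is an orthonormal basis of $U_0$; $HS(U_0;X)$ denotes the Hilbert–Schmidt operators from $U_0$ to $X$. Let $F:\mathbb H\to\mathbb H$ and $B:\mathbb H\to HS(U_0;\mathbb H)$ be Nemytskij operators, i.e.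 for $h=(\mathbf h_1,\mathbf h_2)$, $v\in U_0$ and a.e. $\mathbf x\in\Theta$, $$F(h)(\mathbf x)=-\big(\mathbf J_e,\mathbf J_m\big)(\mathbf x,\mathbf h_1(\mathbf x),\mathbf h_2(\mathbf x)),\qquad (B(h)v)(\mathbf x)=-\big(\mathbf J_e^r,\mathbf J_m^r\big)(\mathbf x,\mathbf h_1(\mathbf x),\mathbf h_2(\mathbf x))\,v(\mathbf x).$$ **Assumption ($\rho=2$).** $F$ maps $\mathcal D(M^2)$ into itself, $B$ maps $\mathcal D(M^2)$ into $HS(U_0;\mathcal D(M^2))$, and for some real constants $\alpha_F,\alpha_B$ and all $u,v\in\mathcal D(M^2)$, $$\langle u-v,F(u)-F(v)\rangle_{\mathcal D(M^2)}\le\alpha_F\|u-v\|^2_{\mathcal D(M^2)},\qquad \|B(u)-B(v)\|_{HS(U_0;\mathcal D(M^2))}\le\alpha_B\|u-v\|_{\mathcal D(M^2)}.$$ Put $\widetilde\alpha_{F,2}=\tfrac12\max\{1+2\alpha_F,\|F(0)\|^2_{\mathcal D(M^2)}\}$ and $\widetilde\alpha_{B,2}=\max\{\alpha_B,\|B(0)\|_{HS(U_0;\mathcal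 D(M^2))}\}$. **Scheme.** On a filtered probability space $(\Omega,\mathcal F,(\mathcal F_t)_{t\ge0},\mathbb P)$ let $(\beta_j)_j$ be a sequence of independent real Brownian motions with respect to $(\mathcal F_t)$ (adapted, the increments of the whole sequence after time $s$ being independent of $\mathcal F_s$), and $W(t)=\sum_j\beta_j(t)Q^{1/2}e_j$. For $\Delta t>0$ and $t_k=k\Delta t$, a numerical solution is a sequence $(u_k)_{k\ge0}$ of $\mathcal D(M^2)$-valued random variables, $u_k$ being $\mathcal F_{t_k}$-measurable, such that almost surely for all $k\ge0$ $$u_{k+1}-u_k=\Delta t\,Mu_{k+1}-\sigma_0\Delta t\,u_{k+1}+\Delta t\,F(u_{k+1})+B(u_k)\Delta W_k,$$ where $B(u_k)\Delta W_k=\sum_j(\beta_j(t_{k+1})-\beta_j(t_k))\,B(u_k)Q^{1/2}e_j$, the series converging in $\mathbb H$ in probability. **Proposition.** If $\sigma_0>\widetilde\alpha_{F,2}+2\widetilde\alpha_{B,2}^2$, then there are constants $C>0$ and $\tau_0>0$, depending only on $\sigma_0,\widetilde\alpha_{F,2},\widetilde\alpha_{B,2}$, such that for every $\Delta t\in(0,\tau_0)$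 and every numerical solution $(u_k)_{k\ge0}$ with $u_0\in L^2(\Omega;\mathcal D(M^2))$, $$\sup_{k\ge0}\mathbb E\big[\|u_k\|^2_{\mathcal D(M^2)}\big]\le C\Big(1+\mathbb E\big[\|u_0\|^2_{\mathcal D(M^2)}\big]\Big).$$ -/

import Mathlib

open MeasureTheory ProbabilityTheory Filter
open scoped NNReal ENNReal Topology InnerProductSpace

noncomputable section

namespace StochMaxwell

/-- Euclidean space `ℝ³`. -/
abbrev E3 : Type := EuclideanSpace ℝ (Fin 3)

/-- The scalar space `L²(Θ)`. -/
abbrev L2S (Θ : Set E3) : Type := Lp ℝ 2 (volume.restrict Θ)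

/-- The space `L²(Θ)³` of square integrable vector fields. -/
abbrev L2V (Θ : Set E3) : Type := Lp E3 2 (volume.restrict Θ)

/-- The Hilbert space `ℍ = L²(Θ)³ × L²(Θ)³` with the Hilbert product norm; an element is written
`(E, H)`, with components `u.fst` and `u.snd`. -/
abbrev HH (Θ : Set E3) : Type := WithLp 2 (L2V Θ × L2V Θ)

/-! ### Curl and the Maxwell operator -/

/-- The partial derivative `∂ᵢ φⱼ`. -/
def partialD (φ : E3 → E3) (i j : Fin 3) (x : E3) : ℝ :=
  (fderiv ℝ φ x (EuclideanSpace.single i 1)) j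

/-- The classical curl of a differentiable vector field. -/
def classicalCurl (φ : E3 → E3) (x : E3) : E3 :=
  !₂[partialD φ 1 2 x - partialD φ 2 1 x,
     partialD φ 2 0 x - partialD φ 0 2 x,
     partialD φ 0 1 x - partialD φ 1 0 x]

/-- Test fields: `C_c^∞(Θ)³`. -/
structure IsTestField (Θ : Set E3) (φ : E3 → E3) : Prop where
  smooth : ContDiff ℝ (⊤ : ℕ∞) φ
  compact : HasCompactSupport φ
  supp : tsupport φ ⊆ Θ

/-- `w` is the distributional curl of `v` on `Θ`:
`∫_Θ v · curl φ = ∫_Θ w · φ` for all test fields `φ`. -/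
def IsWeakCurl (Θ : Set E3) (v w : L2V Θ) : Prop :=
  ∀ φ : E3 → E3, IsTestField Θ φ →
    ∫ x in Θ, ⟪v x, classicalCurl φ x⟫_ℝ = ∫ x in Θ, ⟪w x, φ x⟫_ℝ

/-- The distributional curl of a square integrable field is unique. -/
theorem IsWeakCurl.unique {Θ : Set E3} (hΘ : IsOpen Θ) {v w₁ w₂ : L2V Θ}
    (h₁ : IsWeakCurl Θ v w₁) (h₂ : IsWeakCurl Θ v w₂) : w₁ = w₂ := by
  have key : ∀ᵐ x ∂(volume : Measure E3), x ∈ Θ → (w₁ - w₂ : E3 → E3) x = 0 := by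
    have hloc : ∀ w : L2V Θ, LocallyIntegrableOn (w : E3 → E3) Θ := fun w => by
      have h := (Lp.memLp w).locallyIntegrable (by norm_num)
      intro x hx
      obtain ⟨s, hs, hsi⟩ := h x
      refine ⟨s ∩ Θ, ?_, ?_⟩
      · exact inter_mem (mem_nhdsWithin_of_mem_nhds hs) self_mem_nhdsWithin
      · rwa [IntegrableOn, Measure.restrict_restrict₀' hΘ.measurableSet.nullMeasurableSet] at hsi
    refine hΘ.ae_eq_zero_of_integral_contDiff_smul_eq_zero ((hloc w₁).sub (hloc w₂)) ?_
    intro g hg hgc hgs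
    have hcomp : ∀ (a : E3) (w : L2V Θ), Integrable (fun x => g x • w x) (volume.restrict Θ) := by
      intro a w
      have : IntegrableOn (fun x => g x • w x) (tsupport g) := by
        have h1 : IntegrableOn (w : E3 → E3) (tsupport g) :=
          (hloc w).integrableOn_compact_subset hgs hgc
        exact h1.continuousOn_smul hg.continuous.continuousOn hgc
      have h2 : Integrable (fun x => g x • w x) := by
        rw [← integrableOn_iff_integrable_of_support_subset (s := tsupport g)]
        · exact this
        · intro x hx
          apply subset_tsupport
          intro h0
          apply hx
          simp [h0]
      exact h2.integrableOn
    have hint : ∫ x in Θ, g x • (w₁ x - w₂ x) = 0 := by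
      refine ext_inner_right ℝ fun a => ?_
      have hi : ∀ w : L2V Θ, ∫ x in Θ, ⟪w x, g x • a⟫_ℝ = ⟪∫ x in Θ, g x • w x, a⟫_ℝ := by
        intro w
        rw [real_inner_comm, ← integral_inner (hcomp a w)]
        refine integral_congr_ae (Eventually.of_forall fun x => ?_)
        simp only [real_inner_smul_right]
        rw [real_inner_comm]
      have ht : IsTestField Θ (fun x => g x • a) :=
        ⟨hg.smul contDiff_const, hgc.smul_right,
          (tsupport_smul_subset_left g fun _ => a).trans hgs⟩
      have h := (h₁ _ ht).symm.trans (h₂ _ ht)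
      rw [hi, hi] at h
      have : (fun x => g x • (w₁ x - w₂ x)) = fun x => g x • w₁ x - g x • w₂ x := by
        funext x; rw [smul_sub]
      rw [this, integral_sub (hcomp a w₁) (hcomp a w₂), inner_sub_left, h, sub_self, inner_zero_left]
    rw [setIntegral_eq_integral_of_forall_compl_eq_zero] at hint
    · exact hint
    · intro x hx
      rw [image_eq_zero_of_notMem_tsupport fun h => hx (hgs h), zero_smul]
  apply Lp.ext
  rw [Filter.EventuallyEq, ae_restrict_iff' hΘ.measurableSet]
  filter_upwards [key] with x hx hxΘ
  exact sub_eq_zero.1 (hx hxΘ)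

/-- `H(curl, Θ)`. -/
def Hcurl (Θ : Set E3) : Set (L2V Θ) := {v | ∃ w, IsWeakCurl Θ v w}

open Classical in
/-- The distributional curl of `v ∈ H(curl, Θ)` (and `0` for other `v`). -/
def curl (Θ : Set E3) (v : L2V Θ) : L2V Θ :=
  if h : ∃ w, IsWeakCurl Θ v w then h.choose else 0

/-- `H₀(curl, Θ)`. The condition `n × v = 0` on `∂Θ` is expressed weakly, through Green's formula
`∫_Θ (curl v · φ - v · curl φ) = ∫_∂Θ (n × v) · φ`; on every open set this is the closure
of the test fields in `H(curl, Θ)`. -/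
def Hcurl₀ (Θ : Set E3) : Set (L2V Θ) :=
  {v | v ∈ Hcurl Θ ∧ ∀ φ ∈ Hcurl Θ, ⟪curl Θ v, φ⟫_ℝ = ⟪v, curl Θ φ⟫_ℝ}

/-- The domain `D(M) = H₀(curl, Θ) × H(curl, Θ)`. -/
def domMaxwell (Θ : Set E3) : Set (HH Θ) := {u | u.fst ∈ Hcurl₀ Θ ∧ u.snd ∈ Hcurl Θ}

/-- The Maxwell operator `M (E, H) = (curl H, - curl E)`, meaningful on `D(M)`. -/
def maxwell (Θ : Set E3) (u : HH Θ) : HH Θ :=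
  WithLp.toLp 2 (curl Θ u.snd, - curl Θ u.fst)

/-- The domains `D(M^k)`: `D(M⁰) = ℍ`, `D(M^(k+1)) = {u ∈ D(M^k) : M^k u ∈ D(M)}`. -/
def domPow (Θ : Set E3) : ℕ → Set (HH Θ)
  | 0 => Set.univ
  | k + 1 => {u | u ∈ domPow Θ k ∧ (maxwell Θ)^[k] u ∈ domMaxwell Θ}

/-- The inner product of `D(M^k)`: that of `ℍ` for `k = 0`, and
`⟨u, v⟩ + ⟨M^k u, M^k v⟩` for `k ≥ 1`. -/
def domInner (Θ : Set E3) : ℕ → HH Θ → HH Θ → ℝ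
  | 0, u, v => ⟪u, v⟫_ℝ
  | k + 1, u, v => ⟪u, v⟫_ℝ + ⟪(maxwell Θ)^[k + 1] u, (maxwell Θ)^[k + 1] v⟫_ℝ

/-- The norm of `D(M^k)`. -/
def domNorm (Θ : Set E3) (k : ℕ) (u : HH Θ) : ℝ := √(domInner Θ k u u)

/-! ### Covariance operator, coefficients and Hilbert–Schmidt norms -/

/-- `Q` is a bounded symmetric, positive definite operator and `R = Q^{1/2}` is its
positive square root. -/
structure IsCovarianceRoot {Θ : Set E3} (Q R : L2S Θ →L[ℝ] L2S Θ) : Prop where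
  symm : (Q : L2S Θ →ₗ[ℝ] L2S Θ).IsSymmetric
  posDef : ∀ v : L2S Θ, v ≠ 0 → 0 < ⟪Q v, v⟫_ℝ
  root_pos : R.IsPositive
  root_sq : R ∘L R = Q

/-- The vector space `U₀ = Q^{1/2}(L²(Θ))`, where `R = Q^{1/2}`. Its Hilbert norm is
`‖R g‖_{U₀} = ‖g‖`, so that `(R e_j)_j` is an orthonormal basis of `U₀`
when `(e_j)_j` is one of `L²(Θ)`. -/
abbrev U0 {Θ : Set E3} (R : L2S Θ →L[ℝ] L2S Θ) : Type := LinearMap.range (R : L2S Θ →ₗ[ℝ] L2S Θ)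

/-- The map `Q^{1/2} : L²(Θ) → U₀`. -/
def toU0 {Θ : Set E3} (R : L2S Θ →L[ℝ] L2S Θ) (g : L2S Θ) : U0 R :=
  (R : L2S Θ →ₗ[ℝ] L2S Θ).rangeRestrict g

/-- `T` belongs to `HS(U₀; D(M^ρ))`: it is a bounded operator from `U₀` to `D(M^ρ)`, with
square summable values on an orthonormal basis of `U₀`. -/
structure IsHS {Θ : Set E3} (R : L2S Θ →L[ℝ] L2S Θ) (e : HilbertBasis ℕ ℝ (L2S Θ)) (ρ : ℕ)
    (T : U0 R →ₗ[ℝ] HH Θ) : Prop where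
  maps : ∀ v : U0 R, T v ∈ domPow Θ ρ
  bounded : ∃ K : ℝ, ∀ g : L2S Θ, domNorm Θ ρ (T (toU0 R g)) ≤ K * ‖g‖
  summable : Summable fun j : ℕ => domNorm Θ ρ (T (toU0 R (e j))) ^ 2

/-- The norm of `HS(U₀; D(M^ρ))`. -/
def hsNorm {Θ : Set E3} (R : L2S Θ →L[ℝ] L2S Θ) (e : HilbertBasis ℕ ℝ (L2S Θ)) (ρ : ℕ)
    (T : U0 R →ₗ[ℝ] HH Θ) : ℝ :=
  √(∑' j : ℕ, domNorm Θ ρ (T (toU0 R (e j))) ^ 2)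

/-- `F : ℍ → ℍ` is the Nemytskij operator of the functions `Je`, `Jm`. -/
def IsNemytskijDrift {Θ : Set E3} (Je Jm : E3 → E3 → E3 → E3) (F : HH Θ → HH Θ) : Prop :=
  ∀ h : HH Θ,
    (∀ᵐ x ∂(volume.restrict Θ), (F h).fst x = - Je x (h.fst x) (h.snd x)) ∧
    (∀ᵐ x ∂(volume.restrict Θ), (F h).snd x = - Jm x (h.fst x) (h.snd x))

/-- `B : ℍ → HS(U₀; ℍ)` is the Nemytskij (multiplication) operator of the functions
`Jer`, `Jmr`. -/
def IsNemytskijDiffusion {Θ : Set E3} (R : L2S Θ →L[ℝ] L2S Θ) (e : HilbertBasis ℕ ℝ (L2S Θ))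
    (Jer Jmr : E3 → E3 → E3 → E3) (B : HH Θ → U0 R →ₗ[ℝ] HH Θ) : Prop :=
  ∀ h : HH Θ, IsHS R e 0 (B h) ∧ ∀ v : U0 R,
    (∀ᵐ x ∂(volume.restrict Θ),
      (B h v).fst x = - ((v : L2S Θ) x • Jer x (h.fst x) (h.snd x))) ∧
    (∀ᵐ x ∂(volume.restrict Θ),
      (B h v).snd x = - ((v : L2S Θ) x • Jmr x (h.fst x) (h.snd x)))

/-- The one-sided Lipschitz condition on `F` and the Lipschitz condition on `B` in `D(M^ρ)`, with
constants `αF` and `αB`; that `F` maps `D(M^ρ)` into itself and `B` maps it into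
`HS(U₀; D(M^ρ))` is part of the condition. -/
structure CoeffAssumption {Θ : Set E3} (R : L2S Θ →L[ℝ] L2S Θ) (e : HilbertBasis ℕ ℝ (L2S Θ))
    (ρ : ℕ) (F : HH Θ → HH Θ) (B : HH Θ → U0 R →ₗ[ℝ] HH Θ) (αF αB : ℝ) : Prop where
  drift_maps : ∀ u ∈ domPow Θ ρ, F u ∈ domPow Θ ρ
  drift_oneSided : ∀ u ∈ domPow Θ ρ, ∀ v ∈ domPow Θ ρ,
    domInner Θ ρ (u - v) (F u - F v) ≤ αF * domNorm Θ ρ (u - v) ^ 2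
  diffusion_maps : ∀ u ∈ domPow Θ ρ, IsHS R e ρ (B u)
  diffusion_lipschitz : ∀ u ∈ domPow Θ ρ, ∀ v ∈ domPow Θ ρ,
    hsNorm R e ρ (B u - B v) ≤ αB * domNorm Θ ρ (u - v)

/-- `α̃_{F,ρ} = ½ max {1 + 2 α_{F,ρ}, ‖F(0)‖²_{D(M^ρ)}}`. -/
def growthF {Θ : Set E3} (ρ : ℕ) (F : HH Θ → HH Θ) (αF : ℝ) : ℝ :=
  (1 / 2) * max (1 + 2 * αF) (domNorm Θ ρ (F 0) ^ 2)

/-- `α̃_{B,ρ} = max {α_{B,ρ}, ‖B(0)‖_{HS(U₀; D(M^ρ))}}`. -/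
def growthB {Θ : Set E3} (R : L2S Θ →L[ℝ] L2S Θ) (e : HilbertBasis ℕ ℝ (L2S Θ))
    (ρ : ℕ) (B : HH Θ → U0 R →ₗ[ℝ] HH Θ) (αB : ℝ) : ℝ :=
  max αB (hsNorm R e ρ (B 0))

/-! ### The noise and the scheme -/

/-- `(β_j)_j` is a sequence of independent real Brownian motions with respect to the filtration
`ℱ`: the coordinates of the Wiener process `W(t) = ∑_j β_j(t) Q^{1/2} e_j`. -/
structure IsWienerCoords {Ω : Type*} {mΩ : MeasurableSpace Ω} (P : Measure Ω)
    (ℱ : Filtration ℝ≥0 mΩ) (β : ℕ → ℝ≥0 → Ω → ℝ) : Prop where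
  brownian : ∀ j, IsBrownianReal (β j) P
  indep : iIndepFun (fun (j : ℕ) (ω : Ω) (t : ℝ≥0) => β j t ω) P
  adapted : ∀ j t, StronglyMeasurable[ℱ t] (β j t)
  indep_past : ∀ s t : ℝ≥0, s ≤ t →
    Indep (MeasurableSpace.comap (fun (ω : Ω) (j : ℕ) => β j t ω - β j s ω) MeasurableSpace.pi)
      (ℱ s) P

/-- `ξ = B(v) (W(t) - W(s))`, i.e. `ξ = ∑_j (β_j(t) - β_j(s)) B(v) Q^{1/2} e_j` for the random
element `v`, the series converging in `ℍ` in probability. -/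
def IsNoiseIncrement {Θ : Set E3} {Ω : Type*} {mΩ : MeasurableSpace Ω} (P : Measure Ω)
    (R : L2S Θ →L[ℝ] L2S Θ) (e : HilbertBasis ℕ ℝ (L2S Θ)) (β : ℕ → ℝ≥0 → Ω → ℝ)
    (B : HH Θ → U0 R →ₗ[ℝ] HH Θ) (s t : ℝ≥0) (v ξ : Ω → HH Θ) : Prop :=
  TendstoInMeasure P
    (fun (n : ℕ) (ω : Ω) =>
      ∑ j ∈ Finset.range n, (β j t ω - β j s ω) • B (v ω) (toU0 R (e j)))
    atTop ξ

/-- `(u_k)` is an adapted solution, with values in `D(M²)`, of the semi-implicit Euler scheme with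
step size `τ`,
`u_{k+1} - u_k = τ M u_{k+1} - σ₀ τ u_{k+1} + τ F(u_{k+1}) + B(u_k) (W(t_{k+1}) - W(t_k))`,
where `t_k = k τ`. -/
structure IsEulerSolution {Θ : Set E3} {Ω : Type*} {mΩ : MeasurableSpace Ω} (P : Measure Ω)
    (ℱ : Filtration ℝ≥0 mΩ) (R : L2S Θ →L[ℝ] L2S Θ) (e : HilbertBasis ℕ ℝ (L2S Θ))
    (β : ℕ → ℝ≥0 → Ω → ℝ) (σ₀ : ℝ) (F : HH Θ → HH Θ) (B : HH Θ → U0 R →ₗ[ℝ] HH Θ)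
    (τ : ℝ≥0) (u : ℕ → Ω → HH Θ) : Prop where
  adapted : ∀ k : ℕ, StronglyMeasurable[ℱ ((k : ℝ≥0) * τ)] (u k)
  mem_dom : ∀ k : ℕ, ∀ᵐ ω ∂P, u k ω ∈ domPow Θ 2
  step : ∀ k : ℕ, ∃ ξ : Ω → HH Θ,
    IsNoiseIncrement P R e β B ((k : ℝ≥0) * τ) (((k + 1 : ℕ) : ℝ≥0) * τ) (u k) ξ ∧
    ∀ᵐ ω ∂P, u (k + 1) ω - u k ω =
      (τ : ℝ) • maxwell Θ (u (k + 1) ω) - (σ₀ * (τ : ℝ)) • u (k + 1) ω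
        + (τ : ℝ) • F (u (k + 1) ω) + ξ ω

/-- `E ‖v‖²_{D(M^k)}`, with values in `[0, ∞]`. -/
def meanSq {Θ : Set E3} {Ω : Type*} {mΩ : MeasurableSpace Ω} (P : Measure Ω) (k : ℕ)
    (v : Ω → HH Θ) : ℝ≥0∞ :=
  ∫⁻ ω, ENNReal.ofReal (domNorm Θ k (v ω) ^ 2) ∂P

end StochMaxwell

end

/-! Work in the Hilbert space $\mathcal D(M^2)$, realized as the closed graph of $M^2$. There $M$ is
still skew: if $x$ and $Mx$ lie in $\mathcal D(M^2)$, then $\langle Mx,x\rangle=0$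
(`inner_eq_zero_of_maxwell`). Testing the implicit step with $x=u_{k+1}$ therefore removes $M$ and
leaves the pathwise bound of `energy_le`,
$(1+2\tau(\sigma_0-a_F))\|u_{k+1}\|^2\le\|u_k+\xi_k\|^2+2\tau a_F$, where $\xi_k$ is the noise
increment.

Since $\xi_k$ is built from increments independent of the past, it is orthogonal to $u_k$ in
$L^2(\Omega;\mathcal D(M^2))$, and its second moment is at most $2\tau a_B^2(\mathbb E\|u_k\|^2+1)$
(`exists_noise_limit`, `sum_diffusionCoord_growth`). The scheme only gives $\xi_k$ as a limit in
$\mathbb H$; `IsNoiseIncrement.exists_lift` places it in $\mathcal D(M^2)$.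

Taking expectations, $a_k=\mathbb E\|u_k\|^2$ satisfies $(1+2\tau(\sigma_0-a_F))a_{k+1}\le(1+2\tau
a_B^2)a_k+2\tau(a_B^2+a_F)$. This affine recursion contracts towards
$D=(a_B^2+a_F)/(\sigma_0-a_F-a_B^2)$, so $a_k\le a_0+|D|$ for all $k$. -/

noncomputable section

namespace StochMaxwell

/-! ### Skew-symmetry of the Maxwell operator and the Hilbert space $\mathcal D(M^2)$ -/

section MaxwellGraph

variable {Θ : Set E3}

theorem IsTestField.memLp {φ : E3 → E3} (h : IsTestField Θ φ) :
    MemLp φ 2 (volume.restrict Θ) :=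
  (h.smooth.continuous.memLp_of_hasCompactSupport h.compact).restrict Θ

theorem IsTestField.memLp_classicalCurl {φ : E3 → E3} (h : IsTestField Θ φ) :
    MemLp (classicalCurl φ) 2 (volume.restrict Θ) := by
  have hc : Continuous (fderiv ℝ φ) := h.smooth.continuous_fderiv (by simp)
  have hp : ∀ i j, Continuous (partialD φ i j) := fun i j => by
    unfold partialD
    fun_prop
  refine (Continuous.memLp_of_hasCompactSupport ?_ ?_).restrict Θ
  · unfold classicalCurl
    refine (PiLp.continuous_toLp 2 _).comp (continuous_pi fun i => ?_)
    fin_cases i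
    · exact (hp 1 2).sub (hp 2 1)
    · exact (hp 2 0).sub (hp 0 2)
    · exact (hp 0 1).sub (hp 1 0)
  · refine (h.compact.fderiv (𝕜 := ℝ)).mono fun x hx h0 => hx ?_
    ext i
    fin_cases i <;> simp [classicalCurl, partialD, h0]

theorem setIntegral_inner_eq_inner_toLp (v : L2V Θ) {φ : E3 → E3}
    (hφ : MemLp φ 2 (volume.restrict Θ)) :
    ∫ x in Θ, ⟪v x, φ x⟫_ℝ = ⟪v, hφ.toLp φ⟫_ℝ := by
  rw [L2.inner_def]
  refine integral_congr_ae ?_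
  filter_upwards [hφ.coeFn_toLp] with x hx
  rw [hx]

/-- Pairing with fixed elements of $L^2$ makes the relation visibly linear and closed. -/
theorem isWeakCurl_iff {v w : L2V Θ} :
    IsWeakCurl Θ v w ↔ ∀ φ : E3 → E3, ∀ h : IsTestField Θ φ,
      ⟪v, h.memLp_classicalCurl.toLp _⟫_ℝ = ⟪w, h.memLp.toLp φ⟫_ℝ := by
  refine forall₂_congr fun φ h => ?_
  rw [setIntegral_inner_eq_inner_toLp v h.memLp_classicalCurl,
    setIntegral_inner_eq_inner_toLp w h.memLp]

theorem IsWeakCurl.add {v w v' w' : L2V Θ} (h : IsWeakCurl Θ v w) (h' : IsWeakCurl Θ v' w') :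
    IsWeakCurl Θ (v + v') (w + w') := by
  rw [isWeakCurl_iff] at *
  intro φ hφ
  rw [inner_add_left, inner_add_left, h φ hφ, h' φ hφ]

theorem IsWeakCurl.smul {v w : L2V Θ} (c : ℝ) (h : IsWeakCurl Θ v w) :
    IsWeakCurl Θ (c • v) (c • w) := by
  rw [isWeakCurl_iff] at *
  intro φ hφ
  rw [real_inner_smul_left, real_inner_smul_left, h φ hφ]

theorem IsWeakCurl.zero : IsWeakCurl Θ 0 0 := by
  rw [isWeakCurl_iff]
  intro φ hφ
  rw [inner_zero_left, inner_zero_left]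

theorem IsWeakCurl.of_tendsto {v w : ℕ → L2V Θ} {v' w' : L2V Θ} (h : ∀ n, IsWeakCurl Θ (v n) (w n))
    (hv : Tendsto v atTop (𝓝 v')) (hw : Tendsto w atTop (𝓝 w')) : IsWeakCurl Θ v' w' := by
  rw [isWeakCurl_iff]
  intro φ hφ
  refine tendsto_nhds_unique (hv.inner tendsto_const_nhds) ?_
  refine (hw.inner tendsto_const_nhds).congr fun n => ?_
  rw [isWeakCurl_iff.1 (h n) φ hφ]

theorem isWeakCurl_curl {v : L2V Θ} (h : v ∈ Hcurl Θ) : IsWeakCurl Θ v (curl Θ v) := by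
  have h' : ∃ w, IsWeakCurl Θ v w := h
  rw [curl, dif_pos h']
  exact h'.choose_spec

theorem IsWeakCurl.mem {v w : L2V Θ} (h : IsWeakCurl Θ v w) : v ∈ Hcurl Θ := ⟨w, h⟩

theorem IsWeakCurl.curl_eq (hΘ : IsOpen Θ) {v w : L2V Θ} (h : IsWeakCurl Θ v w) :
    curl Θ v = w :=
  (isWeakCurl_curl h.mem).unique hΘ h

/-- The graph of the Maxwell operator. -/
def IsMaxwell (Θ : Set E3) (u w : HH Θ) : Prop := u ∈ domMaxwell Θ ∧ maxwell Θ u = w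

/-- This removes the chosen value `curl` and the case distinction in its definition: only linear,
closed conditions remain, the last being Green's formula that encodes the boundary condition on the
first component. -/
theorem isMaxwell_iff (hΘ : IsOpen Θ) {u w : HH Θ} :
    IsMaxwell Θ u w ↔ IsWeakCurl Θ u.fst (-w.snd) ∧ IsWeakCurl Θ u.snd w.fst ∧
      ∀ φ ψ, IsWeakCurl Θ φ ψ → ⟪w.snd, φ⟫_ℝ = - ⟪u.fst, ψ⟫_ℝ := by
  constructor
  · rintro ⟨⟨⟨h1, h2⟩, h3⟩, rfl⟩
    refine ⟨by simpa [maxwell] using isWeakCurl_curl h1, by simpa [maxwell] using isWeakCurl_curl h3,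
      fun φ ψ h => ?_⟩
    have := h2 φ h.mem
    rw [h.curl_eq hΘ] at this
    simp [maxwell, inner_neg_left, this]
  · rintro ⟨h1, h2, h3⟩
    refine ⟨⟨⟨h1.mem, fun φ hφ => ?_⟩, h2.mem⟩, ?_⟩
    · rw [h1.curl_eq hΘ, inner_neg_left, h3 φ _ (isWeakCurl_curl hφ), neg_neg]
    · rw [maxwell, h1.curl_eq hΘ, h2.curl_eq hΘ, neg_neg]
      rfl

theorem IsMaxwell.add (hΘ : IsOpen Θ) {u w u' w' : HH Θ} (h : IsMaxwell Θ u w)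
    (h' : IsMaxwell Θ u' w') : IsMaxwell Θ (u + u') (w + w') := by
  rw [isMaxwell_iff hΘ] at *
  refine ⟨?_, h.2.1.add h'.2.1, fun φ ψ hφ => ?_⟩
  · have := h.1.add h'.1
    rwa [← neg_add] at this
  · simp only [WithLp.add_fst, WithLp.add_snd, inner_add_left, h.2.2 φ ψ hφ, h'.2.2 φ ψ hφ]
    ring

theorem IsMaxwell.smul (hΘ : IsOpen Θ) {u w : HH Θ} (c : ℝ) (h : IsMaxwell Θ u w) :
    IsMaxwell Θ (c • u) (c • w) := by
  rw [isMaxwell_iff hΘ] at *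
  refine ⟨?_, h.2.1.smul c, fun φ ψ hφ => ?_⟩
  · have := h.1.smul c
    rwa [smul_neg] at this
  · simp only [WithLp.smul_fst, WithLp.smul_snd, real_inner_smul_left, h.2.2 φ ψ hφ]
    ring

theorem IsMaxwell.zero (hΘ : IsOpen Θ) : IsMaxwell Θ 0 0 := by
  rw [isMaxwell_iff hΘ]
  refine ⟨?_, IsWeakCurl.zero, fun φ ψ _ => by simp⟩
  have := IsWeakCurl.zero (Θ := Θ)
  simpa using this

theorem IsMaxwell.of_tendsto (hΘ : IsOpen Θ) {u w : ℕ → HH Θ} {u' w' : HH Θ}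
    (h : ∀ n, IsMaxwell Θ (u n) (w n))
    (hu : Tendsto u atTop (𝓝 u')) (hw : Tendsto w atTop (𝓝 w')) : IsMaxwell Θ u' w' := by
  simp only [isMaxwell_iff hΘ] at *
  have hf : ∀ {u : ℕ → HH Θ} {u' : HH Θ}, Tendsto u atTop (𝓝 u') →
      Tendsto (fun n => (u n).fst) atTop (𝓝 u'.fst) ∧
      Tendsto (fun n => (u n).snd) atTop (𝓝 u'.snd) := fun {u u'} hu =>
    ⟨(WithLp.fstL 2 ℝ (L2V Θ) (L2V Θ)).continuous.tendsto _ |>.comp hu,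
      (WithLp.sndL 2 ℝ (L2V Θ) (L2V Θ)).continuous.tendsto _ |>.comp hu⟩
  refine ⟨.of_tendsto (fun n => (h n).1) (hf hu).1 (hf hw).2.neg,
    .of_tendsto (fun n => (h n).2.1) (hf hu).2 (hf hw).1, fun φ ψ hφ => ?_⟩
  refine tendsto_nhds_unique ((hf hw).2.inner tendsto_const_nhds) ?_
  refine ((hf hu).1.inner tendsto_const_nhds).neg.congr fun n => ?_
  rw [(h n).2.2 φ ψ hφ]

/-- Green's formula is used twice, each time with the electric component of one pair tested against
the magnetic component of the other. -/
theorem IsMaxwell.inner_eq (hΘ : IsOpen Θ) {u w u' w' : HH Θ} (h : IsMaxwell Θ u w)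
    (h' : IsMaxwell Θ u' w') : ⟪w, u'⟫_ℝ = - ⟪u, w'⟫_ℝ := by
  rw [isMaxwell_iff hΘ] at h h'
  have h1 := h.2.2 _ _ h'.2.1
  have h2 := h'.2.2 _ _ h.2.1
  rw [WithLp.prod_inner_apply, WithLp.prod_inner_apply]
  change ⟪w.fst, u'.fst⟫_ℝ + ⟪w.snd, u'.snd⟫_ℝ = -(⟪u.fst, w'.fst⟫_ℝ + ⟪u.snd, w'.snd⟫_ℝ)
  rw [h1, real_inner_comm, real_inner_comm w'.snd, h2]
  ring

theorem IsMaxwell.inner_self (hΘ : IsOpen Θ) {u w : HH Θ} (h : IsMaxwell Θ u w) :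
    ⟪w, u⟫_ℝ = 0 := by
  have := h.inner_eq hΘ h
  rw [real_inner_comm w u] at this
  linarith

/-- The graph of the square of the Maxwell operator. -/
def IsMaxwellSq (Θ : Set E3) (u w : HH Θ) : Prop := u ∈ domPow Θ 2 ∧ maxwell Θ (maxwell Θ u) = w

theorem isMaxwellSq_iff {u w : HH Θ} :
    IsMaxwellSq Θ u w ↔ ∃ v, IsMaxwell Θ u v ∧ IsMaxwell Θ v w := by
  constructor
  · rintro ⟨⟨⟨_, h1⟩, h2⟩, rfl⟩
    exact ⟨maxwell Θ u, ⟨h1, rfl⟩, ⟨h2, rfl⟩⟩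
  · rintro ⟨_, ⟨h1, rfl⟩, ⟨h2, rfl⟩⟩
    exact ⟨⟨⟨Set.mem_univ _, h1⟩, h2⟩, rfl⟩

/-- The space `D(M²)`, realized as the graph of `M²` in `ℍ × ℍ`. -/
def graphSq (hΘ : IsOpen Θ) : Submodule ℝ (WithLp 2 (HH Θ × HH Θ)) where
  carrier := {p | IsMaxwellSq Θ p.fst p.snd}
  add_mem' := by
    rintro p q hp hq
    obtain ⟨v, h1, h2⟩ := isMaxwellSq_iff.1 hp
    obtain ⟨v', h1', h2'⟩ := isMaxwellSq_iff.1 hq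
    exact isMaxwellSq_iff.2 ⟨_, h1.add hΘ h1', h2.add hΘ h2'⟩
  zero_mem' := isMaxwellSq_iff.2 ⟨0, .zero hΘ, .zero hΘ⟩
  smul_mem' := by
    rintro c p hp
    obtain ⟨v, h1, h2⟩ := isMaxwellSq_iff.1 hp
    exact isMaxwellSq_iff.2 ⟨_, h1.smul hΘ c, h2.smul hΘ c⟩

theorem mem_graphSq {hΘ : IsOpen Θ} {p : WithLp 2 (HH Θ × HH Θ)} :
    p ∈ graphSq hΘ ↔ IsMaxwellSq Θ p.fst p.snd := Iff.rfl

/-- Skew-symmetry gives $\|Mu\|^2=-\langle u,M^2u\rangle\le\|u\|\,\|M^2u\|$, so the intermediate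
values $Mu_n$ converge too, and closedness of $M$ applies twice. -/
theorem isClosed_graphSq (hΘ : IsOpen Θ) :
    IsClosed (graphSq hΘ : Set (WithLp 2 (HH Θ × HH Θ))) := by
  refine IsSeqClosed.isClosed fun p q hp hpq => ?_
  choose v h1 h2 using fun n => isMaxwellSq_iff.1 (mem_graphSq.1 (hp n))
  have hdist : ∀ m n, ‖v m - v n‖ ≤ ‖p m - p n‖ := fun m n => by
    have e1 : IsMaxwell Θ (p m - p n).fst (v m - v n) := by
      have := (h1 m).add hΘ ((h1 n).smul hΘ (-1))
      simpa [neg_one_smul, ← sub_eq_add_neg] using this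
    have e2 : IsMaxwell Θ (v m - v n) (p m - p n).snd := by
      have := (h2 m).add hΘ ((h2 n).smul hΘ (-1))
      simpa [neg_one_smul, ← sub_eq_add_neg] using this
    have h3 := e1.inner_eq hΘ e2
    rw [real_inner_self_eq_norm_sq] at h3
    have h4 := neg_le_of_abs_le (abs_real_inner_le_norm (p m - p n).fst (p m - p n).snd)
    have h5 : ‖p m - p n‖ ^ 2 = ‖(p m - p n).fst‖ ^ 2 + ‖(p m - p n).snd‖ ^ 2 :=
      WithLp.prod_norm_sq_eq_of_L2 _
    refine le_of_sq_le_sq ?_ (norm_nonneg _)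
    nlinarith [sq_nonneg (‖(p m - p n).fst‖ - ‖(p m - p n).snd‖), norm_nonneg (p m - p n).fst,
      norm_nonneg (p m - p n).snd]
  have hv : CauchySeq v := by
    have hc := hpq.cauchySeq
    rw [Metric.cauchySeq_iff] at hc ⊢
    refine fun ε hε => (hc ε hε).imp fun N hN m hm n hn => lt_of_le_of_lt ?_ (hN m hm n hn)
    rw [dist_eq_norm, dist_eq_norm]
    exact hdist m n
  obtain ⟨v', hv'⟩ := cauchySeq_tendsto_of_complete hv
  have t1 := (WithLp.fstL 2 ℝ (HH Θ) (HH Θ)).continuous.tendsto _ |>.comp hpq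
  have t2 := (WithLp.sndL 2 ℝ (HH Θ) (HH Θ)).continuous.tendsto _ |>.comp hpq
  exact isMaxwellSq_iff.2 ⟨v', .of_tendsto hΘ h1 t1 hv', .of_tendsto hΘ h2 hv' t2⟩

instance (hΘ : IsOpen Θ) : CompleteSpace (graphSq hΘ) :=
  (isClosed_graphSq hΘ).completeSpace_coe

/-- The element of `graphSq` given by an element of `D(M²)`. -/
def toGraph (hΘ : IsOpen Θ) {u : HH Θ} (hu : u ∈ domPow Θ 2) : graphSq hΘ :=
  ⟨WithLp.toLp 2 (u, maxwell Θ (maxwell Θ u)), ⟨hu, rfl⟩⟩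

/-- The inclusion of `D(M²)` in `ℍ`. -/
def incl (hΘ : IsOpen Θ) : graphSq hΘ →L[ℝ] HH Θ :=
  (WithLp.fstL 2 ℝ (HH Θ) (HH Θ)).comp (graphSq hΘ).subtypeL

@[simp] theorem incl_toGraph (hΘ : IsOpen Θ) {u : HH Θ} (hu : u ∈ domPow Θ 2) :
    incl hΘ (toGraph hΘ hu) = u := rfl

theorem incl_mem (hΘ : IsOpen Θ) (x : graphSq hΘ) : incl hΘ x ∈ domPow Θ 2 := x.2.1

theorem incl_injective (hΘ : IsOpen Θ) : Function.Injective (incl hΘ) := by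
  rintro ⟨x, hx⟩ ⟨y, hy⟩ h
  have h : x.fst = y.fst := h
  have h2 : x.snd = y.snd := by rw [← hx.2, ← hy.2, h]
  apply Subtype.ext
  apply WithLp.ofLp_injective 2
  exact Prod.ext h h2

theorem norm_incl_le (hΘ : IsOpen Θ) (x : graphSq hΘ) : ‖incl hΘ x‖ ≤ ‖x‖ := by
  have h5 : ‖x‖ ^ 2 = ‖x.1.fst‖ ^ 2 + ‖x.1.snd‖ ^ 2 := WithLp.prod_norm_sq_eq_of_L2 _
  refine le_of_sq_le_sq ?_ (norm_nonneg _)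
  change ‖x.1.fst‖ ^ 2 ≤ _
  nlinarith [sq_nonneg ‖x.1.snd‖]

theorem domInner_incl (hΘ : IsOpen Θ) (x y : graphSq hΘ) :
    domInner Θ 2 (incl hΘ x) (incl hΘ y) = ⟪x, y⟫_ℝ := by
  have h : ⟪x, y⟫_ℝ = ⟪x.1.fst, y.1.fst⟫_ℝ + ⟪x.1.snd, y.1.snd⟫_ℝ := WithLp.prod_inner_apply _ _
  rw [h, ← x.2.2, ← y.2.2]
  rfl

theorem domNorm_incl (hΘ : IsOpen Θ) (x : graphSq hΘ) : domNorm Θ 2 (incl hΘ x) = ‖x‖ := by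
  rw [domNorm, domInner_incl, real_inner_self_eq_norm_sq, Real.sqrt_sq (norm_nonneg _)]

/-- Both parts of the graph inner product vanish by skew-symmetry: $\langle Mx,x\rangle=0$ and
$\langle M(M^2x),M^2x\rangle=0$. The second needs $Mx\in\mathcal D(M^2)$, which puts $M^2x$ in
$\mathcal D(M)$. -/
theorem inner_eq_zero_of_maxwell (hΘ : IsOpen Θ) {x y : graphSq hΘ}
    (h : maxwell Θ (incl hΘ x) = incl hΘ y) : ⟪y, x⟫_ℝ = 0 := by
  obtain ⟨v, h1, h2⟩ := isMaxwellSq_iff.1 x.2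
  obtain ⟨v', h1', h2'⟩ := isMaxwellSq_iff.1 y.2
  have e1 : y.1.fst = v := h.symm.trans h1.2
  have e2 : x.1.snd = v' := by rw [← h1'.2, e1, h2.2]
  have h3 : ⟪y, x⟫_ℝ = ⟪y.1.fst, x.1.fst⟫_ℝ + ⟪y.1.snd, x.1.snd⟫_ℝ := WithLp.prod_inner_apply _ _
  rw [h3, e1, h1.inner_self hΘ, e2, h2'.inner_self hΘ, add_zero]

/-- The energy inequality for `x - w + s t x - t f = t y` when `y` is orthogonal to `x` and `f`
satisfies a one-sided growth condition. -/
theorem energy_le_of_inner_eq_zero {X : Type*} [NormedAddCommGroup X] [InnerProductSpace ℝ X]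
    {x w f f₀ y : X} {α a s t : ℝ} (ht : 0 < t) (hxw : x - w + (s * t) • x - t • f = t • y)
    (h0 : ⟪y, x⟫_ℝ = 0) (hα : ⟪x, f - f₀⟫_ℝ ≤ α * ‖x‖ ^ 2) (h6 : 1 + 2 * α ≤ 2 * a)
    (h7 : ‖f₀‖ ^ 2 ≤ 2 * a) :
    (1 + 2 * t * (s - a)) * ‖x‖ ^ 2 ≤ ‖w‖ ^ 2 + 2 * t * a := by
  have h1 : ⟪x - w + (s * t) • x - t • f, x⟫_ℝ = 0 := by
    rw [hxw, real_inner_smul_left, h0, mul_zero]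
  simp only [inner_add_left, inner_sub_left, real_inner_smul_left] at h1
  rw [real_inner_self_eq_norm_sq] at h1
  rw [inner_sub_right, real_inner_comm] at hα
  have h4 : ⟪x, f₀⟫_ℝ ≤ (‖x‖ ^ 2 + ‖f₀‖ ^ 2) / 2 := by
    have := real_inner_le_norm x f₀
    nlinarith [sq_nonneg (‖x‖ - ‖f₀‖)]
  have h5 : ⟪w, x⟫_ℝ ≤ (‖w‖ ^ 2 + ‖x‖ ^ 2) / 2 := by
    have := real_inner_le_norm w x
    nlinarith [sq_nonneg (‖w‖ - ‖x‖)]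
  -- Young's inequality gives $(1+2\alpha)\|x\|^2+\|f_0\|^2$; bounding both coefficients by $2a$
  -- accounts for the maximum in `growthF`.
  have h8 : 2 * ⟪f, x⟫_ℝ ≤ 2 * a * ‖x‖ ^ 2 + 2 * a := by
    nlinarith [mul_le_mul_of_nonneg_right h6 (sq_nonneg ‖x‖)]
  nlinarith [mul_le_mul_of_nonneg_left h8 ht.le]

/-- The energy inequality in `D(M²)` of one step of the implicit Euler scheme. -/
theorem energy_le (hΘ : IsOpen Θ) {F : HH Θ → HH Θ} {αF σ₀ t : ℝ}
    (hF : ∀ u ∈ domPow Θ 2, F u ∈ domPow Θ 2)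
    (hαF : ∀ u ∈ domPow Θ 2, ∀ v ∈ domPow Θ 2,
      domInner Θ 2 (u - v) (F u - F v) ≤ αF * domNorm Θ 2 (u - v) ^ 2)
    (ht : 0 < t) {x w : graphSq hΘ}
    (h : incl hΘ x = incl hΘ w + t • maxwell Θ (incl hΘ x) - (σ₀ * t) • incl hΘ x
      + t • F (incl hΘ x)) :
    (1 + 2 * t * (σ₀ - growthF 2 F αF)) * ‖x‖ ^ 2 ≤ ‖w‖ ^ 2 + 2 * t * growthF 2 F αF := by
  set f : graphSq hΘ := toGraph hΘ (hF _ (incl_mem hΘ x)) with hf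
  set f₀ : graphSq hΘ := toGraph hΘ (hF _ (incl_mem hΘ 0)) with hf₀
  -- Nothing is known beforehand about $M^2$ of $Mx$; solving the scheme for $Mx$ exhibits it as a
  -- combination of elements of $\mathcal D(M^2)$.
  set y : graphSq hΘ := t⁻¹ • (x - w + (σ₀ * t) • x - t • f) with hy
  have hyM : maxwell Θ (incl hΘ x) = incl hΘ y := by
    have hfx : incl hΘ f = F (incl hΘ x) := rfl
    rw [hy, map_smul, map_sub, map_add, map_sub, map_smul, map_smul, hfx, eq_inv_smul_iff₀ ht.ne']
    nth_rewrite 2 [h]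
    abel
  refine energy_le_of_inner_eq_zero (y := y) (f := f) (f₀ := f₀) (α := αF) ht ?_
    (inner_eq_zero_of_maxwell hΘ hyM) ?_ ?_ ?_
  · rw [hy, smul_inv_smul₀ ht.ne']
  · have := hαF _ (incl_mem hΘ x) _ (incl_mem hΘ 0)
    rw [← map_sub, sub_zero] at this
    rwa [← domNorm_incl, ← domInner_incl, map_sub]
  · unfold growthF
    linarith [le_max_left (1 + 2 * αF) (domNorm Θ 2 (F 0) ^ 2)]
  · have h3 : ‖f₀‖ = domNorm Θ 2 (F 0) := by
      rw [← domNorm_incl, hf₀, incl_toGraph, map_zero]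
    rw [h3]
    unfold growthF
    linarith [le_max_right (1 + 2 * αF) (domNorm Θ 2 (F 0) ^ 2)]

end MaxwellGraph

/-! ### The Itô isometry for one time step -/

section NoiseIncrement

/-- Apply the criterion for orthogonal families of subspaces to the lines spanned by the `y i`. -/
theorem summable_of_orthogonal {H : Type*} [NormedAddCommGroup H] [InnerProductSpace ℝ H]
    [CompleteSpace H] {y : ℕ → H} (ho : ∀ i j, i ≠ j → ⟪y i, y j⟫_ℝ = 0)
    (hs : Summable fun i => ‖y i‖ ^ 2) : Summable y := by
  have hV : OrthogonalFamily ℝ (fun i => (ℝ ∙ y i)) fun i => (ℝ ∙ y i).subtypeₗᵢ := by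
    intro i j hij a b
    obtain ⟨c, hc⟩ := Submodule.mem_span_singleton.1 a.2
    obtain ⟨d, hd⟩ := Submodule.mem_span_singleton.1 b.2
    change ⟪(a : H), (b : H)⟫_ℝ = 0
    rw [← hc, ← hd, real_inner_smul_left, real_inner_smul_right, ho i j hij, mul_zero, mul_zero]
  exact (hV.summable_iff_norm_sq_summable
    fun i => ⟨y i, Submodule.mem_span_singleton_self _⟩).2 hs

theorem norm_add_sum_sq {H : Type*} [NormedAddCommGroup H] [InnerProductSpace ℝ H]
    {y : ℕ → H} {v : H} (ho : ∀ i j, i ≠ j → ⟪y i, y j⟫_ℝ = 0) (hv : ∀ j, ⟪v, y j⟫_ℝ = 0) (n : ℕ) :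
    ‖v + ∑ j ∈ Finset.range n, y j‖ ^ 2 = ‖v‖ ^ 2 + ∑ j ∈ Finset.range n, ‖y j‖ ^ 2 := by
  induction n with
  | zero => simp
  | succ n ih =>
    have h : ⟪v + ∑ j ∈ Finset.range n, y j, y n⟫_ℝ = 0 := by
      rw [inner_add_left, hv, sum_inner, zero_add]
      exact Finset.sum_eq_zero fun j hj => ho j n (Finset.mem_range.1 hj).ne
    rw [Finset.sum_range_succ, Finset.sum_range_succ, ← add_assoc, norm_add_sq_real, ih, h]
    ring

variable {Ω : Type*} {m mΩ : MeasurableSpace Ω} {P : Measure Ω}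

theorem indepFun_of_indep_comap {ζ : ℕ → Ω → ℝ}
    (hind : Indep (MeasurableSpace.comap (fun ω j => ζ j ω) MeasurableSpace.pi) m P)
    {g : (ℕ → ℝ) → ℝ} (hg : Measurable g) {h : Ω → ℝ} (hh : StronglyMeasurable[m] h) :
    IndepFun (fun ω => g fun j => ζ j ω) h P := by
  rw [IndepFun_iff_Indep]
  refine indep_of_indep_of_le_left (indep_of_indep_of_le_right hind ?_) ?_
  · exact hh.measurable.comap_le
  · rintro _ ⟨s, hs, rfl⟩
    exact ⟨g ⁻¹' s, hg hs, rfl⟩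

theorem norm_toLp_sq {X : Type*} [NormedAddCommGroup X] [InnerProductSpace ℝ X] {f : Ω → X}
    (hf : MemLp f 2 P) : ‖hf.toLp f‖ ^ 2 = ∫ ω, ‖f ω‖ ^ 2 ∂P := by
  rw [← real_inner_self_eq_norm_sq, L2.inner_def]
  refine integral_congr_ae ?_
  filter_upwards [hf.coeFn_toLp] with ω hω
  rw [hω, real_inner_self_eq_norm_sq]

theorem inner_toLp_toLp {X : Type*} [NormedAddCommGroup X] [InnerProductSpace ℝ X] {f g : Ω → X}
    (hf : MemLp f 2 P) (hg : MemLp g 2 P) :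
    ⟪hf.toLp f, hg.toLp g⟫_ℝ = ∫ ω, ⟪f ω, g ω⟫_ℝ ∂P := by
  rw [L2.inner_def]
  refine integral_congr_ae ?_
  filter_upwards [hf.coeFn_toLp, hg.coeFn_toLp] with ω hω hω'
  rw [hω, hω']

/-- Convergence and second moment of the noise increment `∑ j, ζ j • b j`, where the `b j` are
measurable with respect to the past and the `ζ j` are independent of it. -/
theorem exists_noise_limit {X : Type*} [NormedAddCommGroup X] [InnerProductSpace ℝ X]
    [CompleteSpace X] (hm : m ≤ mΩ) {ζ : ℕ → Ω → ℝ} {t : ℝ} (ht : 0 ≤ t)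
    (hζL : ∀ j, MemLp (ζ j) 2 P) (hζ0 : ∀ j, ∫ ω, ζ j ω ∂P = 0)
    (hζ2 : ∀ j, ∫ ω, ζ j ω * ζ j ω ∂P = t) (hζ : ∀ i j, i ≠ j → ∫ ω, ζ i ω * ζ j ω ∂P = 0)
    (hind : Indep (MeasurableSpace.comap (fun ω j => ζ j ω) MeasurableSpace.pi) m P)
    {v : Ω → X} {b : ℕ → Ω → X} (hv : StronglyMeasurable[m] v) (hvL : MemLp v 2 P)
    (hb : ∀ j, StronglyMeasurable[m] (b j)) {G : Ω → ℝ} (hG : Integrable G P)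
    (hbG : ∀ ω n, ∑ j ∈ Finset.range n, ‖b j ω‖ ^ 2 ≤ G ω) :
    ∃ Ξ : Ω → X, MemLp Ξ 2 P ∧
      TendstoInMeasure P (fun n ω => ∑ j ∈ Finset.range n, ζ j ω • b j ω) atTop Ξ ∧
      ∫ ω, ‖v ω + Ξ ω‖ ^ 2 ∂P ≤ ∫ ω, ‖v ω‖ ^ 2 ∂P + t * ∫ ω, G ω ∂P := by
  have hbi : ∀ j, Integrable (fun ω => ‖b j ω‖ ^ 2) P := fun j => by
    refine hG.mono' (((hb j).mono hm).norm.pow 2).aestronglyMeasurable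
      (Eventually.of_forall fun ω => ?_)
    rw [Real.norm_of_nonneg (sq_nonneg _)]
    refine le_trans ?_ (hbG ω (j + 1))
    exact Finset.single_le_sum (f := fun j => ‖b j ω‖ ^ 2) (fun _ _ => sq_nonneg _)
      (Finset.mem_range.2 j.lt_succ_self)
  have hindp : ∀ i j (h : Ω → ℝ), StronglyMeasurable[m] h →
      IndepFun (fun ω => ζ i ω * ζ j ω) h P := fun i j h hh =>
    indepFun_of_indep_comap hind (g := fun x => x i * x j) (by fun_prop) hh
  have hinds : ∀ j (h : Ω → ℝ), StronglyMeasurable[m] h →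
      IndepFun (fun ω => ζ j ω) h P := fun j h hh =>
    indepFun_of_indep_comap hind (g := fun x => x j) (by fun_prop) hh
  have hyL : ∀ j, MemLp (fun ω => ζ j ω • b j ω) 2 P := fun j => by
    have hms : AEStronglyMeasurable (fun ω => ζ j ω • b j ω) P :=
      (hζL j).1.smul ((hb j).mono hm).aestronglyMeasurable
    rw [memLp_two_iff_integrable_sq_norm hms]
    have h1 : Integrable (fun ω => ζ j ω * ζ j ω) P := by
      simpa only [sq] using (hζL j).integrable_sq
    have h2 := (hindp j j _ ((hb j).norm.pow 2)).integrable_mul h1 (hbi j)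
    refine h2.congr (Eventually.of_forall fun ω => ?_)
    simp only [Pi.mul_apply, Pi.pow_apply, norm_smul, mul_pow, Real.norm_eq_abs, sq_abs]
    ring
  set y : ℕ → Lp X 2 P := fun j => (hyL j).toLp _ with hy
  have hnorm : ∀ j, ‖y j‖ ^ 2 = t * ∫ ω, ‖b j ω‖ ^ 2 ∂P := fun j => by
    have h := (hindp j j (fun ω => ‖b j ω‖ ^ 2) ((hb j).norm.pow 2)).integral_fun_mul_eq_mul_integral
        ((hζL j).1.mul (hζL j).1) (hbi j).1
    rw [hζ2 j] at h
    rw [hy, norm_toLp_sq, ← h]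
    refine integral_congr_ae (Eventually.of_forall fun ω => ?_)
    simp only [norm_smul, mul_pow, Real.norm_eq_abs, sq_abs]
    ring
  -- Independence of the past factors $\mathbb E[\zeta_i\zeta_j\langle b_i,b_j\rangle]$, and the
  -- noise factor is zero.
  have ho : ∀ i j, i ≠ j → ⟪y i, y j⟫_ℝ = 0 := fun i j hij => by
    have hbb : StronglyMeasurable[m] fun ω => ⟪b i ω, b j ω⟫_ℝ := (hb i).inner (hb j)
    have h := (hindp i j _ hbb).integral_fun_mul_eq_mul_integral
        ((hζL i).1.mul (hζL j).1) (hbb.mono hm).aestronglyMeasurable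
    rw [hζ i j hij, zero_mul] at h
    rw [hy, inner_toLp_toLp, ← h]
    refine integral_congr_ae (Eventually.of_forall fun ω => ?_)
    simp only [real_inner_smul_left, real_inner_smul_right]
    ring
  have hvo : ∀ j, ⟪hvL.toLp v, y j⟫_ℝ = 0 := fun j => by
    have hbb : StronglyMeasurable[m] fun ω => ⟪v ω, b j ω⟫_ℝ := hv.inner (hb j)
    have h := (hinds j _ hbb).integral_fun_mul_eq_mul_integral
        (hζL j).1 (hbb.mono hm).aestronglyMeasurable
    rw [hζ0 j, zero_mul] at h
    rw [hy, inner_toLp_toLp, ← h]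
    refine integral_congr_ae (Eventually.of_forall fun ω => ?_)
    simp only [real_inner_smul_right]
  have hbound : ∀ n, ∑ j ∈ Finset.range n, ‖y j‖ ^ 2 ≤ t * ∫ ω, G ω ∂P := fun n => by
    simp only [hnorm]
    rw [← Finset.mul_sum, ← integral_finsetSum _ fun j _ => hbi j]
    refine mul_le_mul_of_nonneg_left ?_ ht
    exact integral_mono (integrable_finsetSum _ fun j _ => hbi j) hG fun ω => hbG ω n
  have hsum : Summable y := summable_of_orthogonal ho <|
    summable_of_sum_range_le (fun _ => sq_nonneg _) hbound
  have hlim := hsum.hasSum.tendsto_sum_nat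
  refine ⟨(∑' j, y j : Lp X 2 P), Lp.memLp _, ?_, ?_⟩
  · refine (tendstoInMeasure_of_tendsto_Lp hlim).congr_left fun n => ?_
    refine (Lp.coeFn_finsetSum _ _).trans ?_
    have h : ∀ᵐ ω ∂P, ∀ j, y j ω = ζ j ω • b j ω := ae_all_iff.2 fun j => (hyL j).coeFn_toLp
    filter_upwards [h] with ω hω
    simp [hω]
  · have h1 : ∫ ω, ‖v ω + (∑' j, y j : Lp X 2 P) ω‖ ^ 2 ∂P = ‖hvL.toLp v + ∑' j, y j‖ ^ 2 := by
      rw [← real_inner_self_eq_norm_sq, L2.inner_def]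
      refine integral_congr_ae ?_
      filter_upwards [hvL.coeFn_toLp, Lp.coeFn_add (hvL.toLp v) (∑' j, y j)] with ω h1 h2
      rw [h2, Pi.add_apply, h1, real_inner_self_eq_norm_sq]
    rw [h1, ← norm_toLp_sq hvL]
    -- Pythagoras bounds every partial sum, and the bound passes to the $L^2$ limit.
    refine le_of_tendsto ((hlim.const_add _).norm.pow 2) (Eventually.of_forall fun n => ?_)
    rw [norm_add_sum_sq ho hvo]
    exact add_le_add_right (hbound n) _

/-- The moments of the increments of a sequence of independent Brownian motions. -/
theorem IsWienerCoords.increment_moments {ℱ : Filtration ℝ≥0 mΩ}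
    {β : ℕ → ℝ≥0 → Ω → ℝ} (h : IsWienerCoords P ℱ β) (s t : ℝ≥0) :
    (∀ j, MemLp (fun ω => β j t ω - β j s ω) 2 P) ∧
    (∀ j, ∫ ω, (β j t ω - β j s ω) ∂P = 0) ∧
    (∀ j, ∫ ω, (β j t ω - β j s ω) * (β j t ω - β j s ω) ∂P = |(t : ℝ) - s|) ∧
    ∀ i j, i ≠ j → ∫ ω, (β i t ω - β i s ω) * (β j t ω - β j s ω) ∂P = 0 := by
  have hlaw : ∀ j, HasLaw (fun ω => β j t ω - β j s ω) (gaussianReal 0 (nndist t.1 s.1)) P :=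
    fun j => (h.brownian j).toIsPreBrownianReal.hasLaw_sub t s
  have h0 : ∀ j, ∫ ω, (β j t ω - β j s ω) ∂P = 0 := fun j => by
    rw [(hlaw j).integral_eq, integral_id_gaussianReal]
  refine ⟨fun j => ?_, h0, fun j => ?_, fun i j hij => ?_⟩
  · exact (hlaw j).hasGaussianLaw.memLp_two
  · have h1 := (hlaw j).variance_eq
    rw [variance_id_gaussianReal, variance_of_integral_eq_zero (hlaw j).aemeasurable (h0 j)] at h1
    simp only [← sq]
    rw [h1, coe_nndist, Real.dist_eq]
    rfl
  · have hij' : IndepFun (fun ω => β i t ω - β i s ω) (fun ω => β j t ω - β j s ω) P :=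
      (h.indep.indepFun hij).comp (φ := fun x : ℝ≥0 → ℝ => x t - x s)
        (ψ := fun x : ℝ≥0 → ℝ => x t - x s) (by fun_prop) (by fun_prop)
    rw [hij'.integral_fun_mul_eq_mul_integral (hlaw i).aemeasurable.aestronglyMeasurable
      (hlaw j).aemeasurable.aestronglyMeasurable, h0, zero_mul]

end NoiseIncrement

/-! ### Measurability in $\mathcal D(M^2)$ and growth of the diffusion -/

section Scheme

variable {Θ : Set E3}

instance (hΘ : IsOpen Θ) : SecondCountableTopology (graphSq hΘ) :=
  have : Fact ((2 : ℝ≥0∞) ≠ ∞) := ⟨ENNReal.ofNat_ne_top⟩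
  have _ : SecondCountableTopology (L2V Θ) := inferInstance
  have _ : SecondCountableTopology (HH Θ) := WithLp.secondCountableTopology 2 _ _
  have _ : SecondCountableTopology (WithLp 2 (HH Θ × HH Θ)) := WithLp.secondCountableTopology 2 _ _
  TopologicalSpace.Subtype.secondCountableTopology _

/-- Elements of `D(M²)` are recovered measurably from their images in `ℍ`. -/
theorem exists_measurable_lift (hΘ : IsOpen Θ) (Ω : Type*) : ∃ φ : HH Θ → graphSq hΘ,
    (∀ x, φ (incl hΘ x) = x) ∧ ∀ (m : MeasurableSpace Ω) (u : Ω → HH Θ), StronglyMeasurable[m] u →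
      StronglyMeasurable[m] fun ω => φ (u ω) := by
  borelize (HH Θ)
  let _ : MeasurableSpace (graphSq hΘ) := borel _
  have _ : BorelSpace (graphSq hΘ) := ⟨rfl⟩
  -- Lusin–Souslin: a continuous injection of a Polish space is a measurable embedding, hence has a
  -- measurable left inverse.
  have hemb : MeasurableEmbedding (incl hΘ) :=
    (incl hΘ).continuous.measurableEmbedding (incl_injective hΘ)
  obtain ⟨φ, hφ, hφi⟩ := hemb.exists_measurable_extend measurable_id fun _ => ⟨0⟩
  exact ⟨φ, congr_fun hφi, fun m u hu => (hφ.comp hu.measurable).stronglyMeasurable⟩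

section Diffusion

variable {R : L2S Θ →L[ℝ] L2S Θ} {e : HilbertBasis ℕ ℝ (L2S Θ)} {B : HH Θ → U0 R →ₗ[ℝ] HH Θ}

/-- The maps `x ↦ B(x) Q^{1/2} e_j` of `D(M²)`. -/
def diffusionCoord (hΘ : IsOpen Θ) (hB : ∀ u ∈ domPow Θ 2, IsHS R e 2 (B u)) (j : ℕ)
    (x : graphSq hΘ) : graphSq hΘ :=
  toGraph hΘ ((hB _ (incl_mem hΘ x)).maps (toU0 R (e j)))

theorem sum_diffusionCoord_le (hΘ : IsOpen Θ) (hB : ∀ u ∈ domPow Θ 2, IsHS R e 2 (B u))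
    (x : graphSq hΘ) (n : ℕ) :
    ∑ j ∈ Finset.range n, ‖diffusionCoord hΘ hB j x‖ ^ 2 ≤ hsNorm R e 2 (B (incl hΘ x)) ^ 2 := by
  rw [hsNorm, Real.sq_sqrt (tsum_nonneg fun _ => sq_nonneg _)]
  refine le_trans (Finset.sum_le_sum fun j _ => ?_)
    ((hB _ (incl_mem hΘ x)).summable.sum_le_tsum (Finset.range n) fun _ _ => sq_nonneg _)
  rw [← domNorm_incl]
  rfl

theorem sum_diffusionCoord_sub_le (hΘ : IsOpen Θ) (hB : ∀ u ∈ domPow Θ 2, IsHS R e 2 (B u))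
    (x y : graphSq hΘ) (n : ℕ) :
    ∑ j ∈ Finset.range n, ‖diffusionCoord hΘ hB j x - diffusionCoord hΘ hB j y‖ ^ 2 ≤
      hsNorm R e 2 (B (incl hΘ x) - B (incl hΘ y)) ^ 2 := by
  have hd : ∀ j, domNorm Θ 2 ((B (incl hΘ x) - B (incl hΘ y)) (toU0 R (e j))) =
      ‖diffusionCoord hΘ hB j x - diffusionCoord hΘ hB j y‖ := fun j => by
    rw [← domNorm_incl, map_sub]
    rfl
  have hs : ∀ x : graphSq hΘ, Summable fun j => ‖diffusionCoord hΘ hB j x‖ ^ 2 := fun x =>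
    summable_of_sum_range_le (fun _ => sq_nonneg _) (sum_diffusionCoord_le hΘ hB x)
  -- `IsHS` is given for values of `B`, not for differences; without summability the `tsum` in
  -- `hsNorm` would be 0 and bound nothing.
  have hsd : Summable fun j => ‖diffusionCoord hΘ hB j x - diffusionCoord hΘ hB j y‖ ^ 2 := by
    refine Summable.of_nonneg_of_le (fun _ => sq_nonneg _) (fun j => ?_)
      (((hs x).add (hs y)).mul_left 2)
    have := norm_sub_le (diffusionCoord hΘ hB j x) (diffusionCoord hΘ hB j y)
    nlinarith [sq_nonneg (‖diffusionCoord hΘ hB j x‖ - ‖diffusionCoord hΘ hB j y‖),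
      norm_nonneg (diffusionCoord hΘ hB j x - diffusionCoord hΘ hB j y)]
  rw [hsNorm, Real.sq_sqrt (tsum_nonneg fun _ => sq_nonneg _)]
  simp only [hd]
  exact hsd.sum_le_tsum _ fun _ _ => sq_nonneg _

variable {F : HH Θ → HH Θ} {αF αB : ℝ}

theorem growthB_nonneg : 0 ≤ growthB R e 2 B αB := le_max_of_le_right (Real.sqrt_nonneg _)

theorem hsNorm_sub_le (hΘ : IsOpen Θ) (h : CoeffAssumption R e 2 F B αF αB) (x y : graphSq hΘ) :
    hsNorm R e 2 (B (incl hΘ x) - B (incl hΘ y)) ≤ growthB R e 2 B αB * ‖x - y‖ := by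
  refine (h.diffusion_lipschitz _ (incl_mem hΘ x) _ (incl_mem hΘ y)).trans ?_
  rw [← map_sub, domNorm_incl]
  exact mul_le_mul_of_nonneg_right (le_max_left _ _) (norm_nonneg _)

/-- One coordinate is dominated by the Hilbert–Schmidt norm. Continuity makes the coefficients of
the noise measurable with respect to the past. -/
theorem continuous_diffusionCoord (hΘ : IsOpen Θ) (h : CoeffAssumption R e 2 F B αF αB) (j : ℕ) :
    Continuous (diffusionCoord hΘ h.diffusion_maps j) := by
  refine (LipschitzWith.of_dist_le_mul (K := ⟨growthB R e 2 B αB, growthB_nonneg⟩)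
    fun x y => ?_).continuous
  rw [dist_eq_norm, dist_eq_norm]
  refine le_trans ?_ (hsNorm_sub_le hΘ h x y)
  refine le_of_sq_le_sq ?_ (Real.sqrt_nonneg _)
  refine le_trans ?_ (sum_diffusionCoord_sub_le hΘ h.diffusion_maps x y (j + 1))
  exact Finset.single_le_sum
    (f := fun j => ‖diffusionCoord hΘ h.diffusion_maps j x -
      diffusionCoord hΘ h.diffusion_maps j y‖ ^ 2) (fun _ _ => sq_nonneg _)
    (Finset.mem_range.2 j.lt_succ_self)

/-- The factor 2 comes from splitting $B(x)=(B(x)-B(0))+B(0)$. -/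
theorem sum_diffusionCoord_growth (hΘ : IsOpen Θ) (h : CoeffAssumption R e 2 F B αF αB)
    (x : graphSq hΘ) (n : ℕ) :
    ∑ j ∈ Finset.range n, ‖diffusionCoord hΘ h.diffusion_maps j x‖ ^ 2 ≤
      2 * growthB R e 2 B αB ^ 2 * (‖x‖ ^ 2 + 1) := by
  have h1 := sum_diffusionCoord_sub_le hΘ h.diffusion_maps x 0 n
  have h2 := sum_diffusionCoord_le hΘ h.diffusion_maps 0 n
  have h3 := pow_le_pow_left₀ (Real.sqrt_nonneg _) (hsNorm_sub_le hΘ h x 0) 2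
  have h4 : hsNorm R e 2 (B (incl hΘ 0)) ^ 2 ≤ growthB R e 2 B αB ^ 2 := by
    rw [map_zero]
    exact pow_le_pow_left₀ (Real.sqrt_nonneg _) (le_max_right _ _) 2
  rw [sub_zero, mul_pow] at h3
  have h5 : ∑ j ∈ Finset.range n, ‖diffusionCoord hΘ h.diffusion_maps j x‖ ^ 2 ≤
      2 * (∑ j ∈ Finset.range n, ‖diffusionCoord hΘ h.diffusion_maps j x -
        diffusionCoord hΘ h.diffusion_maps j 0‖ ^ 2 +
        ∑ j ∈ Finset.range n, ‖diffusionCoord hΘ h.diffusion_maps j 0‖ ^ 2) := by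
    rw [← Finset.sum_add_distrib, Finset.mul_sum]
    refine Finset.sum_le_sum fun j _ => ?_
    have := norm_add_le (diffusionCoord hΘ h.diffusion_maps j x -
      diffusionCoord hΘ h.diffusion_maps j 0) (diffusionCoord hΘ h.diffusion_maps j 0)
    rw [sub_add_cancel] at this
    nlinarith [sq_nonneg (‖diffusionCoord hΘ h.diffusion_maps j x -
      diffusionCoord hΘ h.diffusion_maps j 0‖ - ‖diffusionCoord hΘ h.diffusion_maps j 0‖),
      norm_nonneg (diffusionCoord hΘ h.diffusion_maps j x)]
  have h6 := h1.trans h3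
  have h7 := h2.trans h4
  linarith

/-! ### Second moments over one step of the scheme -/

variable {Ω : Type*} {mΩ : MeasurableSpace Ω} {P : Measure Ω} [IsProbabilityMeasure P]
  {ℱ : Filtration ℝ≥0 mΩ} {β : ℕ → ℝ≥0 → Ω → ℝ} {σ₀ : ℝ} {τ : ℝ≥0} {u : ℕ → Ω → HH Θ}

/-- The noise increment takes values in `D(M²)`, with the expected bound of the second moment. -/
theorem IsNoiseIncrement.exists_lift (hΘ : IsOpen Θ) (h : CoeffAssumption R e 2 F B αF αB)
    (hβ : IsWienerCoords P ℱ β) {s t : ℝ≥0} (hst : s ≤ t) {v ξ : Ω → HH Θ}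
    (hξ : IsNoiseIncrement P R e β B s t v ξ) {V : Ω → graphSq hΘ}
    (hVm : StronglyMeasurable[ℱ s] V) (hV : ∀ᵐ ω ∂P, incl hΘ (V ω) = v ω) (hVL : MemLp V 2 P) :
    ∃ Ξ : Ω → graphSq hΘ, MemLp Ξ 2 P ∧ (fun ω => incl hΘ (Ξ ω)) =ᵐ[P] ξ ∧
      ∫ ω, ‖V ω + Ξ ω‖ ^ 2 ∂P ≤ ∫ ω, ‖V ω‖ ^ 2 ∂P
        + (t - s) * (2 * growthB R e 2 B αB ^ 2 * (∫ ω, ‖V ω‖ ^ 2 ∂P + 1)) := by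
  have hts : (0 : ℝ) ≤ t - s := sub_nonneg.2 (NNReal.coe_le_coe.2 hst)
  obtain ⟨m1, m2, m3, m4⟩ := hβ.increment_moments s t
  have hVi : Integrable (fun ω => ‖V ω‖ ^ 2) P := hVL.integrable_norm_pow two_ne_zero
  have hG : Integrable (fun ω => 2 * growthB R e 2 B αB ^ 2 * (‖V ω‖ ^ 2 + 1)) P :=
    (hVi.add (integrable_const 1)).const_mul _
  obtain ⟨Ξ, hΞL, hΞ, hΞ2⟩ := exists_noise_limit (ℱ.le s) hts m1 m2
    (fun j => (m3 j).trans (abs_of_nonneg hts)) m4 (hβ.indep_past s t hst) hVm hVL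
    (fun j => (continuous_diffusionCoord hΘ h j).comp_stronglyMeasurable hVm) hG
    (fun ω n => sum_diffusionCoord_growth hΘ h (V ω) n)
  refine ⟨Ξ, hΞL, tendstoInMeasure_ae_unique ?_ hξ, hΞ2.trans (le_of_eq ?_)⟩
  -- `incl` is a contraction, so convergence in measure in $\mathcal D(M^2)$ descends to $\mathbb
  -- H$, where a.e. uniqueness of limits identifies the image of `Ξ` with `ξ`.
  · have h1 : TendstoInMeasure P (fun (n : ℕ) (ω : Ω) => incl hΘ (∑ j ∈ Finset.range n,
        (β j t ω - β j s ω) • diffusionCoord hΘ h.diffusion_maps j (V ω))) atTop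
        (fun ω => incl hΘ (Ξ ω)) := by
      intro ε hε
      refine tendsto_of_tendsto_of_tendsto_of_le_of_le tendsto_const_nhds (hΞ ε hε)
        (fun _ => zero_le) fun n => measure_mono fun ω hω => ?_
      refine le_trans (show ε ≤ _ from hω) ?_
      rw [edist_eq_enorm_sub, edist_eq_enorm_sub, ← map_sub]
      exact enorm_le_iff_norm_le.2 (norm_incl_le hΘ _)
    refine h1.congr_left fun n => ?_
    filter_upwards [hV] with ω hω
    rw [map_sum]
    refine Finset.sum_congr rfl fun j _ => ?_
    rw [map_smul, diffusionCoord, incl_toGraph, hω]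
  · rw [integral_const_mul, integral_add hVi (integrable_const _), integral_const, probReal_univ,
      one_smul]

/-- Square integrability of the iterates after the first is not assumed; the pathwise energy bound
supplies it. -/
theorem memLp_and_integral_le_of_ae_le {X : Type*} [NormedAddCommGroup X] {V W : Ω → X}
    {c d : ℝ} (hc : 0 < c) (hV : AEStronglyMeasurable V P) (hW : MemLp W 2 P)
    (h : ∀ᵐ ω ∂P, c * ‖V ω‖ ^ 2 ≤ ‖W ω‖ ^ 2 + d) :
    MemLp V 2 P ∧ c * ∫ ω, ‖V ω‖ ^ 2 ∂P ≤ ∫ ω, ‖W ω‖ ^ 2 ∂P + d := by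
  have hWi : Integrable (fun ω => ‖W ω‖ ^ 2) P := hW.integrable_norm_pow two_ne_zero
  have hWd : Integrable (fun ω => ‖W ω‖ ^ 2 + d) P := hWi.add (integrable_const _)
  have hi : Integrable (fun ω => c * ‖V ω‖ ^ 2) P := by
    refine hWd.mono' ((hV.norm.pow 2).const_mul _) ?_
    filter_upwards [h] with ω hω
    rwa [Real.norm_of_nonneg (by positivity)]
  have hi' : Integrable (fun ω => ‖V ω‖ ^ 2) P := by
    refine (hi.const_mul c⁻¹).congr (Eventually.of_forall fun ω => ?_)
    exact inv_mul_cancel_left₀ hc.ne' _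
  refine ⟨(memLp_two_iff_integrable_sq_norm hV).2 hi', ?_⟩
  rw [← integral_const_mul]
  refine (integral_mono_ae hi hWd h).trans (le_of_eq ?_)
  rw [integral_add hWi (integrable_const _), integral_const, probReal_univ, one_smul]

/-- One step of the scheme in terms of second moments in `D(M²)`. -/
theorem IsEulerSolution.moment_step (hΘ : IsOpen Θ) (h : CoeffAssumption R e 2 F B αF αB)
    (hβ : IsWienerCoords P ℱ β) (hτ : 0 < τ) (hσ : growthF 2 F αF < σ₀)
    (hu : IsEulerSolution P ℱ R e β σ₀ F B τ u) {U : ℕ → Ω → graphSq hΘ}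
    (hUm : ∀ k : ℕ, StronglyMeasurable[ℱ ((k : ℝ≥0) * τ)] (U k))
    (hU : ∀ k, ∀ᵐ ω ∂P, incl hΘ (U k ω) = u k ω) {k : ℕ} (hk : MemLp (U k) 2 P) :
    MemLp (U (k + 1)) 2 P ∧
      (1 + 2 * τ * (σ₀ - growthF 2 F αF)) * ∫ ω, ‖U (k + 1) ω‖ ^ 2 ∂P ≤
        ∫ ω, ‖U k ω‖ ^ 2 ∂P
          + τ * (2 * growthB R e 2 B αB ^ 2 * (∫ ω, ‖U k ω‖ ^ 2 ∂P + 1))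
          + 2 * τ * growthF 2 F αF := by
  have ht : (((k + 1 : ℕ) : ℝ≥0) * τ) = (k : ℝ≥0) * τ + τ := by push_cast; ring
  obtain ⟨ξ, hξ, hstep⟩ := hu.step k
  obtain ⟨Ξ, hΞL, hΞ, hΞ2⟩ := hξ.exists_lift hΘ h hβ (ht ▸ le_self_add) (hUm k) (hU k) hk
  rw [ht, NNReal.coe_add, add_sub_cancel_left] at hΞ2
  have hpos : 0 < 1 + 2 * (τ : ℝ) * (σ₀ - growthF 2 F αF) := by
    have := sub_pos.2 hσ
    positivity
  have hen : ∀ᵐ ω ∂P, (1 + 2 * (τ : ℝ) * (σ₀ - growthF 2 F αF)) * ‖U (k + 1) ω‖ ^ 2 ≤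
      ‖(U k + Ξ) ω‖ ^ 2 + 2 * τ * growthF 2 F αF := by
    filter_upwards [hU k, hU (k + 1), hΞ, hstep] with ω h1 h2 h3 h4
    refine energy_le hΘ h.drift_maps h.drift_oneSided (NNReal.coe_pos.2 hτ) ?_
    rw [Pi.add_apply, map_add, h1, h3, h2]
    refine (sub_eq_iff_eq_add.1 h4).trans ?_
    abel
  obtain ⟨hL, hle⟩ := memLp_and_integral_le_of_ae_le hpos
    ((hUm (k + 1)).mono (ℱ.le _)).aestronglyMeasurable (hk.add hΞL) hen
  refine ⟨hL, hle.trans ?_⟩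
  gcongr
  exact hΞ2

end Diffusion

end Scheme

end StochMaxwell

end

/-! ### The moment recursion and the uniform bound -/

open StochMaxwell in
theorem proposition3p4 (σ₀ aF aB : ℝ) (hσ : aF + 2 * aB ^ 2 < σ₀) :
    ∃ C : ℝ, 0 < C ∧ ∃ τ₀ : ℝ≥0, 0 < τ₀ ∧
      ∀ (Θ : Set E3), IsOpen Θ → IsConnected Θ → Bornology.IsBounded Θ →
      ∀ (Q R : L2S Θ →L[ℝ] L2S Θ), IsCovarianceRoot Q R →
      ∀ (e : HilbertBasis ℕ ℝ (L2S Θ))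
        (Je Jm Jer Jmr : E3 → E3 → E3 → E3)
        (F : HH Θ → HH Θ), IsNemytskijDrift Je Jm F →
      ∀ (B : HH Θ → U0 R →ₗ[ℝ] HH Θ), IsNemytskijDiffusion R e Jer Jmr B →
      ∀ (αF αB : ℝ), CoeffAssumption R e 2 F B αF αB →
        growthF 2 F αF = aF → growthB R e 2 B αB = aB →
      ∀ (Ω : Type*) (mΩ : MeasurableSpace Ω) (P : Measure Ω), IsProbabilityMeasure P →
      ∀ (ℱ : Filtration ℝ≥0 mΩ) (β : ℕ → ℝ≥0 → Ω → ℝ), IsWienerCoords P ℱ β →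
      ∀ (τ : ℝ≥0), 0 < τ → τ < τ₀ →
      ∀ (u : ℕ → Ω → HH Θ), IsEulerSolution P ℱ R e β σ₀ F B τ u →
        meanSq P 2 (u 0) < ∞ →
        ⨆ k : ℕ, meanSq P 2 (u k) ≤ ENNReal.ofReal C * (1 + meanSq P 2 (u 0)) := by
  -- The fixed point of the moment recursion, independent of the step size. The recursion contracts
  -- for every positive step, so $\tau_0=1$ is an arbitrary choice.
  set D : ℝ := (aB ^ 2 + aF) / (σ₀ - aF - aB ^ 2) with hD
  refine ⟨1 + |D|, by positivity, 1, one_pos, ?_⟩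
  intro Θ hΘ _ _ Q R _ e Je Jm Jer Jmr F _ B _ αF αB h hF hB Ω mΩ P _ ℱ β hβ τ hτ _ u hu hu0
  obtain ⟨φ, hφ, hφm⟩ := exists_measurable_lift hΘ Ω
  set U : ℕ → Ω → graphSq hΘ := fun k ω => φ (u k ω) with hUdef
  have hUm : ∀ k : ℕ, StronglyMeasurable[ℱ ((k : ℝ≥0) * τ)] (U k) := fun k =>
    hφm _ _ (hu.adapted k)
  have hU : ∀ k, ∀ᵐ ω ∂P, incl hΘ (U k ω) = u k ω := fun k => by
    filter_upwards [hu.mem_dom k] with ω hω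
    have : φ (u k ω) = toGraph hΘ hω := hφ (toGraph hΘ hω)
    rw [hUdef]
    simp only [this, incl_toGraph]
  have hmean : ∀ k, meanSq P 2 (u k) = ∫⁻ ω, ENNReal.ofReal (‖U k ω‖ ^ 2) ∂P := fun k => by
    refine lintegral_congr_ae ?_
    filter_upwards [hU k] with ω hω
    rw [← hω, domNorm_incl]
  have hms : ∀ k, AEStronglyMeasurable (U k) P := fun k =>
    ((hUm k).mono (ℱ.le _)).aestronglyMeasurable
  have h0 : MemLp (U 0) 2 P := by
    rw [memLp_two_iff_integrable_sq_norm (hms 0)]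
    exact (lintegral_ofReal_ne_top_iff_integrable ((hms 0).norm.pow 2)
      (Eventually.of_forall fun ω => sq_nonneg _)).1 (hmean 0 ▸ hu0).ne
  have hmean' : ∀ k, MemLp (U k) 2 P →
      meanSq P 2 (u k) = ENNReal.ofReal (∫ ω, ‖U k ω‖ ^ 2 ∂P) := fun k hk => by
    rw [hmean, ofReal_integral_eq_lintegral_ofReal (hk.integrable_norm_pow two_ne_zero)
      (Eventually.of_forall fun ω => sq_nonneg _)]
  set a₀ := ∫ ω, ‖U 0 ω‖ ^ 2 ∂P with ha₀
  have ha₀0 : 0 ≤ a₀ := integral_nonneg fun ω => sq_nonneg _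
  have hτ' : (0 : ℝ) < τ := NNReal.coe_pos.2 hτ
  have hden : 0 < σ₀ - aF - aB ^ 2 := by nlinarith [sq_nonneg aB]
  have hDmul : D * (σ₀ - aF - aB ^ 2) = aB ^ 2 + aF := div_mul_cancel₀ _ hden.ne'
  -- `MemLp` is part of the induction: the next step requires it, and the Bochner integral of a
  -- nonintegrable function would be 0.
  have key : ∀ k, MemLp (U k) 2 P ∧ ∫ ω, ‖U k ω‖ ^ 2 ∂P ≤ a₀ + |D| := by
    intro k
    induction k with
    | zero => exact ⟨h0, le_add_of_nonneg_right (abs_nonneg _)⟩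
    | succ k ih =>
      obtain ⟨h1, h2⟩ := hu.moment_step hΘ h hβ hτ (by nlinarith [sq_nonneg aB]) hUm hU ih.1
      refine ⟨h1, ?_⟩
      rw [hF, hB] at h2
      have hpos : 0 < 1 + 2 * (τ : ℝ) * (σ₀ - aF) := by
        have : 0 < σ₀ - aF := by nlinarith [sq_nonneg aB]
        positivity
      refine le_of_mul_le_mul_left (h2.trans ?_) hpos
      -- Any level at or above the fixed point `D` is preserved by the recursion.
      have h3 : aB ^ 2 + aF ≤ (a₀ + |D|) * (σ₀ - aF - aB ^ 2) := by
        rw [← hDmul]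
        exact mul_le_mul_of_nonneg_right (by linarith [le_abs_self D]) hden.le
      have h4 := mul_le_mul_of_nonneg_left ih.2 (mul_nonneg hτ'.le (sq_nonneg aB))
      have h5 := mul_le_mul_of_nonneg_left h3 hτ'.le
      linarith [ih.2]
  refine iSup_le fun k => ?_
  rw [hmean' k (key k).1, hmean' 0 h0, ← ENNReal.ofReal_one, ← ENNReal.ofReal_add zero_le_one ha₀0,
    ← ENNReal.ofReal_mul (by positivity)]
  refine ENNReal.ofReal_le_ofReal ((key k).2.trans ?_)
  nlinarith [mul_nonneg (abs_nonneg D) ha₀0]
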